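/- Call a complex $n\times n$ matrix $M=(m_{ij})$ *hollow* if $m_{ii}=0$ for all $i=1,\dots,n$, and *almost hollow* if $m_{ii}=0$ for $i=1,\dots,n-2$ and $m_{n-1,n-1}=-m_{nn}$ (for $n=1$ this is read as $m_{11}=0$). Let $A,B,C\in\mathbb{C}^{n\times n}$ be Hermitian matrices with $\operatorname{tr}A=\operatorname{tr}B=\operatorname{tr}C=0$. (a) If $n\ge 3$, there exists $v\in\mathbb{C}^n\setminus\{0\}$ such that $v^*Av=v^*Bv=v^*Cv=0$. (b) There exists a unitary matrix $V\in\mathbb{C}^{n\times n}$ such that $V^*AV$ and $V^*BV$ are hollow, while $V^*CV$ is almost hollow. -/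

import Mathlib

open scoped Matrix

/-- A square matrix is hollow if all its diagonal entries vanish. -/
def IsHollow {n : ℕ} (A : Matrix (Fin n) (Fin n) ℂ) : Prop :=
  ∀ i, A i i = 0

/-- A square matrix is almost hollow if its first `n - 2` diagonal entries vanish and the last two
are negatives of each other. For `n = 1`, where there is no last-but-one entry, that entry is read
as zero, so that the single entry of the matrix has to vanish. (Indices are counted from `0`.) -/
def IsAlmostHollow {n : ℕ} (A : Matrix (Fin n) (Fin n) ℂ) : Prop :=
  (∀ i : Fin n, (i : ℕ) + 2 < n → A i i = 0) ∧
  (∀ i j : Fin n, (i : ℕ) + 2 = n → (j : ℕ) + 1 = n → A i i = -A j j) ∧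
  (n = 1 → ∀ i, A i i = 0)

open scoped ComplexConjugate InnerProductSpace

/-! The core is a statement about `ℂ³`: if `A` and `B` have zero diagonal in an orthonormal triple
and `C` has opposite signs on two of its vectors, then the three forms have a common zero in the
span. The forms of `A` and `B` combine into the single complex form of `A + iB`. A path in its zero
set, running from the vector where `C` is negative to the one where it is positive, meets a zero of
`C` (`exists_hollowForm_eq_zero`).

The rest is bookkeeping with orthonormal bases. Bases hollow for `A` and `B` come from the same path
argument in planes (`exists_hollow_pair`). While `C` has three nonzero diagonal entries, two of them
have opposite signs since the trace is zero. A common isotropic vector replaces one basis vector,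
and the number of nonzero entries drops. At most two remain; moved to the end, they are opposite by
the trace. For `n ≥ 3` the first basis vector then proves (a). -/

/-- The real-linear map `x ↦ w * x + b * conj x` is singular when `‖w‖ = ‖b‖`. -/
theorem exists_ne_zero_mul_add_mul_conj_eq_zero {w b : ℂ} (h : ‖w‖ = ‖b‖) :
    ∃ k : ℂ, k ≠ 0 ∧ w * k + b * conj k = 0 := by
  have hwb : w * conj w = b * conj b := by
    rw [Complex.mul_conj, Complex.mul_conj, Complex.normSq_eq_norm_sq, Complex.normSq_eq_norm_sq, h]
  -- The adjugate `y ↦ conj w * y - b * conj y` maps into the kernel; its values at `1` and `I`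
  -- vanish together only if `w = b = 0`.
  by_cases h1 : conj w - b = 0
  · by_cases hb : b = 0
    · have hw : w = 0 := by simpa [hb] using h1
      exact ⟨1, one_ne_zero, by simp [hw, hb]⟩
    · refine ⟨conj w * Complex.I + b * Complex.I, ?_, ?_⟩
      · rw [sub_eq_zero.mp h1, ← two_mul]
        simp [hb]
      · simp only [map_add, map_mul, Complex.conj_I, Complex.conj_conj]
        linear_combination Complex.I * hwb
  · refine ⟨conj w - b, h1, ?_⟩
    simp only [map_sub, Complex.conj_conj]
    linear_combination hwb

/-! ### Zeros of forms on `ℂ³` -/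

/-- A sesquilinear form on `ℂ³` with zero diagonal. -/
def hollowForm (p q a c b d : ℂ) (v : ℂ × ℂ × ℂ) : ℂ :=
  p * (conj v.1 * v.2.1) + q * (conj v.2.1 * v.1) + a * (conj v.1 * v.2.2) +
    c * (conj v.2.2 * v.1) + b * (conj v.2.1 * v.2.2) + d * (conj v.2.2 * v.2.1)

theorem hollowForm_smul (p q a c b d r : ℂ) (v : ℂ × ℂ × ℂ) :
    hollowForm p q a c b d (r • v) = conj r * r * hollowForm p q a c b d v := by
  simp only [hollowForm, Prod.smul_fst, Prod.smul_snd, smul_eq_mul, map_mul]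
  ring

theorem continuous_hollowForm (p q a c b d : ℂ) : Continuous (hollowForm p q a c b d) := by
  unfold hollowForm
  have := Complex.continuous_conj
  fun_prop

/-- A continuous function on a real path that changes sign vanishes at a point of it. -/
theorem exists_eq_zero_of_path {X : Type*} [TopologicalSpace X] {g : X → ℝ} (hg : Continuous g)
    {P : ℝ → X} (hP : Continuous P) {r s : ℝ} (hrs : r ≤ s) (h0 : g (P r) ≤ 0) (h1 : 0 ≤ g (P s)) :
    ∃ t ∈ Set.Icc r s, g (P t) = 0 := by
  have := intermediate_value_Icc hrs (hg.comp hP).continuousOn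
  exact this ⟨h0, h1⟩

/-- Two coordinate vectors are joined by zeros of a form if the off-diagonal entries between them
have the same modulus. -/
theorem exists_hollowForm_eq_zero_of_norm_eq {p q : ℂ} (a c b d : ℂ) (h : ‖p‖ = ‖q‖)
    {g : ℂ × ℂ × ℂ → ℝ} (hg : Continuous g) (hgs : ∀ (r : ℂ) v, g (r • v) = ‖r‖ ^ 2 * g v)
    (h1 : g (1, 0, 0) ≤ 0) (h2 : 0 ≤ g (0, 1, 0)) :
    ∃ v : ℂ × ℂ × ℂ, v ≠ 0 ∧ v.2.2 = 0 ∧ hollowForm p q a c b d v = 0 ∧ g v = 0 := by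
  obtain ⟨k, hk, hk0⟩ := exists_ne_zero_mul_add_mul_conj_eq_zero h
  let P : ℝ → ℂ × ℂ × ℂ := fun t => ((1 - t : ℝ), (t : ℂ) * k, 0)
  have hP : Continuous P := by fun_prop
  have e2 : P 1 = k • (0, 1, 0) := by simp [P]
  obtain ⟨t, ht, h0⟩ := exists_eq_zero_of_path hg hP zero_le_one (by simpa [P] using h1)
    (by rw [e2, hgs]; positivity)
  refine ⟨P t, fun hv => ?_, rfl, ?_, h0⟩
  · have h3 : ((1 - t : ℝ) : ℂ) = 0 := congrArg Prod.fst hv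
    have h4 : (t : ℂ) * k = 0 := congrArg (fun v => v.2.1) hv
    have h5 : t = 0 := by simpa [hk] using h4
    simp [h5] at h3
  · simp only [hollowForm, P, map_mul, Complex.conj_ofReal, map_zero]
    linear_combination ((1 - t : ℝ) : ℂ) * t * hk0

/-- The case where the form is normalised in the plane of the first two coordinates. -/
theorem exists_hollowForm_eq_zero_of_one_zero (a c b d : ℂ)
    {g : ℂ × ℂ × ℂ → ℝ} (hg : Continuous g) (hgs : ∀ (r : ℂ) v, g (r • v) = ‖r‖ ^ 2 * g v)
    (h1 : g (1, 0, 0) < 0) (h2 : 0 < g (0, 1, 0)) :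
    ∃ v : ℂ × ℂ × ℂ, v ≠ 0 ∧ hollowForm 1 0 a c b d v = 0 ∧ g v = 0 := by
  by_contra! hne
  -- With first coordinate `ζ t` and third coordinate `t`, the form vanishes iff the second one
  -- solves `s y + t b conj y = t ρ`, a real-linear equation of determinant `D`. The choice of `s`
  -- makes `D` positive on `[0, 1)` and zero at `1`. Scaling by `D` clears the denominator.
  let s : ℝ → ℝ := fun t => t * ‖b‖ + (1 - t)
  let D : ℝ → ℝ := fun t => (s t) ^ 2 - (t * ‖b‖) ^ 2
  let ζ : ℝ → ℂ := fun t => s t - t * conj d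
  let ρ : ℝ → ℂ := fun t => -(a * conj (ζ t) + c * ζ t)
  let Y : ℝ → ℂ := fun t => t * (s t * ρ t - t * b * conj (ρ t))
  let P : ℝ → ℂ × ℂ × ℂ := fun t => (D t * ζ t, Y t, (t * D t : ℝ))
  have hc := Complex.continuous_conj
  have hζ : Continuous ζ := by fun_prop
  have hP : Continuous P := by fun_prop
  have hbb : b * conj b = (‖b‖ : ℂ) ^ 2 := by
    rw [Complex.mul_conj, Complex.normSq_eq_norm_sq]; norm_cast
  have hFP : ∀ t, hollowForm 1 0 a c b d (P t) = 0 := by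
    intro t
    have hDt : ((D t : ℝ) : ℂ) = (s t) ^ 2 - (t * ‖b‖) ^ 2 := by simp [D]
    have hz : conj (ζ t) + t * d = s t := by simp [ζ]
    have hY : s t * Y t + t * b * conj (Y t) = t * D t * ρ t := by
      simp only [Y, hDt, map_mul, map_sub, Complex.conj_ofReal, Complex.conj_conj]
      linear_combination (-(t : ℂ) ^ 3 * ρ t) * hbb
    have hr : ρ t = -(a * conj (ζ t) + c * ζ t) := rfl
    simp only [hollowForm, P, map_mul, Complex.conj_ofReal, Complex.ofReal_mul]
    linear_combination (D t : ℂ) * Y t * hz + (D t : ℂ) * hY - t * (D t : ℂ) ^ 2 * hr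
  have hDpos : ∀ t, 0 ≤ t → t < 1 → 0 < D t := by
    intro t h0 h1
    have : D t = (1 - t) * (1 - t + 2 * (t * ‖b‖)) := by simp only [D, s]; ring
    rw [this]
    have : 0 ≤ t * ‖b‖ := by positivity
    apply mul_pos <;> linarith
  have hP0 : P 0 = (1, 0, 0) := by simp [P, D, s, ζ, Y]
  have hPne : ∀ t, 0 ≤ t → t < 1 → P t ≠ 0 := by
    intro t h0 h1 h
    have h3 : ((t * D t : ℝ) : ℂ) = 0 := congrArg (fun v => v.2.2) h
    have h4 : t * D t = 0 := by exact_mod_cast h3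
    rcases mul_eq_zero.mp h4 with h5 | h5
    · rw [h5, hP0] at h
      simp at h
    · exact (hDpos t h0 h1).ne' h5
  have hgP : ∀ t, 0 ≤ t → t < 1 → g (P t) ≤ 0 := by
    intro t h0 ht1
    by_contra! hpos
    obtain ⟨r, hr, hr0⟩ := exists_eq_zero_of_path hg hP h0 (by rw [hP0]; exact h1.le) hpos.le
    exact hne _ (hPne r hr.1 (hr.2.trans_lt ht1)) (hFP r) hr0
  -- a limit of the normalised path at its singular end point
  let τ : ℕ → ℝ := fun m => 1 - 1 / ((m : ℝ) + 1)
  have hτ0 : ∀ m, 0 ≤ τ m := by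
    intro m
    have : 1 / ((m : ℝ) + 1) ≤ 1 := by
      rw [div_le_one (by positivity)]
      linarith [(Nat.cast_nonneg m : (0 : ℝ) ≤ m)]
    simp only [τ]; linarith
  have hτ1 : ∀ m, τ m < 1 := by
    intro m
    have : 0 < 1 / ((m : ℝ) + 1) := by positivity
    simp only [τ]; linarith
  have hτ : Filter.Tendsto τ Filter.atTop (nhds 1) := by
    simpa only [τ, sub_zero] using
      tendsto_const_nhds (x := (1 : ℝ)).sub (tendsto_one_div_add_atTop_nhds_zero_nat (𝕜 := ℝ))
  let u : ℕ → ℂ × ℂ × ℂ := fun m => ((‖P (τ m)‖⁻¹ : ℝ) : ℂ) • P (τ m)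
  have hu : ∀ m, u m ∈ Metric.sphere (0 : ℂ × ℂ × ℂ) 1 := by
    intro m
    have := norm_ne_zero_iff.mpr (hPne _ (hτ0 m) (hτ1 m))
    simp only [u, mem_sphere_zero_iff_norm, norm_smul, Complex.norm_real, norm_inv, norm_norm]
    field_simp
  obtain ⟨y, hy, φ, hφ, hlim⟩ := (isCompact_sphere (0 : ℂ × ℂ × ℂ) 1).tendsto_subseq hu
  have hy0 : y ≠ 0 := by
    rintro rfl
    simp at hy
  have hFy : hollowForm 1 0 a c b d y = 0 := by
    refine tendsto_nhds_unique
      (((continuous_hollowForm 1 0 a c b d).tendsto y).comp hlim) ?_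
    have : (hollowForm 1 0 a c b d ∘ u ∘ φ) = fun _ => 0 := by
      funext m
      simp only [Function.comp, u, hollowForm_smul, hFP, mul_zero]
    rw [this]
    exact tendsto_const_nhds
  have hgy : g y ≤ 0 := by
    refine le_of_tendsto ((hg.tendsto y).comp hlim) (Filter.Eventually.of_forall fun m => ?_)
    simp only [Function.comp, u, hgs]
    exact mul_nonpos_of_nonneg_of_nonpos (by positivity) (hgP _ (hτ0 _) (hτ1 _))
  -- The ratio of the first and third coordinates is free of `D`, so it survives the limit.
  have hrel : (1 : ℂ) * y.1 = ζ 1 * y.2.2 := by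
    have hτφ := hτ.comp hφ.tendsto_atTop
    have ht1 : Filter.Tendsto (fun m => ((τ (φ m) : ℝ) : ℂ) * (u (φ m)).1) Filter.atTop
        (nhds ((1 : ℝ) * y.1)) :=
      ((Complex.continuous_ofReal.tendsto _).comp hτφ).mul ((continuous_fst.tendsto y).comp hlim)
    have ht2 : Filter.Tendsto (fun m => ζ (τ (φ m)) * (u (φ m)).2.2) Filter.atTop
        (nhds (ζ 1 * y.2.2)) :=
      ((hζ.tendsto _).comp hτφ).mul (((continuous_snd.comp continuous_snd).tendsto y).comp hlim)
    rw [Complex.ofReal_one] at ht1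
    refine tendsto_nhds_unique ht1 (ht2.congr fun m => ?_)
    simp only [u, P, Prod.smul_fst, Prod.smul_snd, smul_eq_mul, Complex.ofReal_mul]
    ring
  rw [one_mul] at hrel
  by_cases hz : y.2.2 = 0
  · have hy1 : y.1 = 0 := by rw [hrel, hz, mul_zero]
    have hyy : y = y.2.1 • (0, 1, 0) := by
      ext <;> simp [hy1, hz]
    have hy2 : y.2.1 ≠ 0 := fun h => hy0 (by rw [hyy, h, zero_smul])
    rw [hyy, hgs] at hgy
    have : 0 < ‖y.2.1‖ ^ 2 := by positivity
    nlinarith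
  · -- the solutions over the end point form a line
    have hs1 : s 1 = ‖b‖ := by simp [s]
    have hζ1 : conj (ζ 1) + d = ‖b‖ := by simp [ζ, hs1]
    obtain ⟨k, hk, hk0⟩ := exists_ne_zero_mul_add_mul_conj_eq_zero
      (w := (‖b‖ : ℂ)) (b := b) (by simp)
    set η := y.2.1 / y.2.2 with hη
    have hyη : (y.2.2)⁻¹ • y = (ζ 1, η, 1) := by
      ext
      · simp [hrel]; field_simp
      · simp [hη]; field_simp
      · simp [hz]
    have hFη : hollowForm 1 0 a c b d (ζ 1, η, 1) = 0 := by
      rw [← hyη, hollowForm_smul, hFy, mul_zero]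
    have hgη : g (ζ 1, η, 1) ≤ 0 := by
      rw [← hyη, hgs]
      exact mul_nonpos_of_nonneg_of_nonpos (by positivity) hgy
    -- In projective terms this is the solution line `η + ℝ k`, followed to its point at infinity,
    -- the second coordinate vector.
    let Q : ℝ → ℂ × ℂ × ℂ := fun t =>
      ((1 - t : ℝ) * ζ 1, (1 - t : ℝ) * η + t * k, (1 - t : ℝ))
    have hQ : Continuous Q := by fun_prop
    have e2 : Q 1 = k • (0, 1, 0) := by simp [Q]
    obtain ⟨t, -, h0⟩ := exists_eq_zero_of_path hg hQ zero_le_one (by simpa [Q] using hgη)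
      (by rw [e2, hgs]; positivity)
    refine hne (Q t) (fun hv => ?_) ?_ h0
    · have h3 : ((1 - t : ℝ) : ℂ) = 0 := congrArg (fun v => v.2.2) hv
      have h4 : ((1 - t : ℝ) : ℂ) * η + t * k = 0 := congrArg (fun v => v.2.1) hv
      have h5 : t = 1 := by
        have : 1 - t = 0 := by exact_mod_cast h3
        linarith
      simp [h5, hk] at h4
    · simp only [hollowForm, map_one] at hFη
      simp only [hollowForm, Q, map_mul, map_add, Complex.conj_ofReal]
      linear_combination ((1 - t : ℝ) : ℂ) ^ 2 * hFη + ((1 - t : ℝ) : ℂ) * t * hk0 +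
        ((1 - t : ℝ) : ℂ) * t * k * hζ1

/-- A continuous, absolutely quadratic function with opposite signs at two coordinate vectors
of `ℂ³` has a nontrivial common zero with any sesquilinear form of zero diagonal. -/
theorem exists_hollowForm_eq_zero (p q a c b d : ℂ)
    {g : ℂ × ℂ × ℂ → ℝ} (hg : Continuous g) (hgs : ∀ (r : ℂ) v, g (r • v) = ‖r‖ ^ 2 * g v)
    (h1 : g (1, 0, 0) < 0) (h2 : 0 < g (0, 1, 0)) :
    ∃ v : ℂ × ℂ × ℂ, v ≠ 0 ∧ hollowForm p q a c b d v = 0 ∧ g v = 0 := by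
  by_cases h : ‖p‖ = ‖q‖
  · obtain ⟨v, hv, -, hF, hgv⟩ := exists_hollowForm_eq_zero_of_norm_eq a c b d h hg hgs h1.le h2.le
    exact ⟨v, hv, hF, hgv⟩
  set δ : ℂ := p * conj p - q * conj q with hδ
  have hδ0 : δ ≠ 0 := by
    rw [hδ, Complex.mul_conj, Complex.mul_conj, Complex.normSq_eq_norm_sq,
      Complex.normSq_eq_norm_sq, sub_ne_zero]
    intro h'
    exact h ((sq_eq_sq₀ (norm_nonneg _) (norm_nonneg _)).mp (by exact_mod_cast h'))
  obtain ⟨v, hv, hF, hgv⟩ := exists_hollowForm_eq_zero_of_one_zero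
    ((conj p * a - q * conj c) / δ) ((conj p * c - q * conj a) / δ)
    ((conj p * b - q * conj d) / δ) ((conj p * d - q * conj b) / δ) hg hgs h1 h2
  refine ⟨v, hv, ?_, hgv⟩
  -- The normalised form is `(conj p * X - q * conj X) / δ`; as `‖p‖ ≠ ‖q‖`, it has the same zeros
  -- as `X`.
  set X := hollowForm p q a c b d v with hX
  have hXY : conj p * X - q * conj X = 0 := by
    rw [← mul_zero δ, ← hF, hX]
    simp only [hollowForm, map_add, map_mul, Complex.conj_conj]
    field_simp
    rw [hδ]
    ring
  by_contra hX0
  have : ‖conj p * X‖ = ‖q * conj X‖ := by rw [sub_eq_zero.mp hXY]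
  rw [norm_mul, norm_mul, RCLike.norm_conj, RCLike.norm_conj] at this
  exact h (mul_right_cancel₀ (norm_ne_zero_iff.mpr hX0) this)

/-! ### Common isotropic vectors of symmetric operators -/

section HollowBases

variable {E : Type*} [NormedAddCommGroup E] [InnerProductSpace ℂ E]

theorem inner_combination_eq_hollowForm (T : E →ₗ[ℂ] E) {e₁ e₂ e₃ : E}
    (h₁ : ⟪e₁, T e₁⟫_ℂ = 0) (h₂ : ⟪e₂, T e₂⟫_ℂ = 0) (h₃ : ⟪e₃, T e₃⟫_ℂ = 0) (v : ℂ × ℂ × ℂ) :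
    ⟪v.1 • e₁ + v.2.1 • e₂ + v.2.2 • e₃, T (v.1 • e₁ + v.2.1 • e₂ + v.2.2 • e₃)⟫_ℂ =
      hollowForm ⟪e₁, T e₂⟫_ℂ ⟪e₂, T e₁⟫_ℂ ⟪e₁, T e₃⟫_ℂ ⟪e₃, T e₁⟫_ℂ ⟪e₂, T e₃⟫_ℂ ⟪e₃, T e₂⟫_ℂ v := by
  simp only [map_add, map_smul, inner_add_left, inner_add_right, inner_smul_left, inner_smul_right,
    h₁, h₂, h₃, hollowForm]
  ring

theorem re_inner_combination_smul (T : E →ₗ[ℂ] E) (e₁ e₂ e₃ : E) (r : ℂ) (v : ℂ × ℂ × ℂ) :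
    (⟪(r • v).1 • e₁ + (r • v).2.1 • e₂ + (r • v).2.2 • e₃,
      T ((r • v).1 • e₁ + (r • v).2.1 • e₂ + (r • v).2.2 • e₃)⟫_ℂ).re =
    ‖r‖ ^ 2 * (⟪v.1 • e₁ + v.2.1 • e₂ + v.2.2 • e₃,
      T (v.1 • e₁ + v.2.1 • e₂ + v.2.2 • e₃)⟫_ℂ).re := by
  have : (r • v).1 • e₁ + (r • v).2.1 • e₂ + (r • v).2.2 • e₃ =
      r • (v.1 • e₁ + v.2.1 • e₂ + v.2.2 • e₃) := by
    simp only [Prod.smul_fst, Prod.smul_snd, smul_eq_mul, mul_smul, smul_add]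
  rw [this, map_smul, inner_smul_left, inner_smul_right, ← mul_assoc, mul_comm (conj r),
    Complex.mul_conj, Complex.re_ofReal_mul, Complex.normSq_eq_norm_sq]

theorem continuous_re_inner_combination (T : E →ₗ[ℂ] E) (e₁ e₂ e₃ : E) :
    Continuous fun v : ℂ × ℂ × ℂ => (⟪v.1 • e₁ + v.2.1 • e₂ + v.2.2 • e₃,
      T (v.1 • e₁ + v.2.1 • e₂ + v.2.2 • e₃)⟫_ℂ).re := by
  simp only [map_add, map_smul]
  fun_prop

theorem inner_map_self_eq_zero_of_re {T : E →ₗ[ℂ] E} (hT : T.IsSymmetric) {v : E}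
    (h : (⟪v, T v⟫_ℂ).re = 0) : ⟪v, T v⟫_ℂ = 0 := by
  rw [← hT.coe_re_inner_self_apply v]
  simpa using h

/-- The orthogonality clause stands in for membership in a span; it is the form that
`OrthonormalBasis.exists_replace` consumes. -/
theorem exists_unit_smul_isotropic {w : E} (hw : w ≠ 0) :
    ∃ v : E, ‖v‖ = 1 ∧ (∀ x, ⟪x, w⟫_ℂ = 0 → ⟪x, v⟫_ℂ = 0) ∧
      ∀ T : E →ₗ[ℂ] E, ⟪w, T w⟫_ℂ = 0 → ⟪v, T v⟫_ℂ = 0 := by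
  refine ⟨((‖w‖⁻¹ : ℝ) : ℂ) • w, ?_, fun x hx => ?_, fun T hT => ?_⟩
  · have := norm_ne_zero_iff.mpr hw
    rw [norm_smul, Complex.norm_real, norm_inv, norm_norm]
    field_simp
  · rw [inner_smul_right, hx, mul_zero]
  · rw [map_smul, inner_smul_left, inner_smul_right, hT, mul_zero, mul_zero]

/-- Two symmetric operators have a common isotropic unit vector in a plane. -/
theorem exists_isotropic_mem_plane {A B : E →ₗ[ℂ] E} (hA : A.IsSymmetric) (hB : B.IsSymmetric)
    {e₁ e₂ : E} (n₁ : ‖e₁‖ = 1) (n₂ : ‖e₂‖ = 1) (o₁₂ : ⟪e₁, e₂⟫_ℂ = 0)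
    (hA₁ : ⟪e₁, A e₁⟫_ℂ = 0) (hA₂ : ⟪e₂, A e₂⟫_ℂ = 0)
    (hB₁ : (⟪e₁, B e₁⟫_ℂ).re < 0) (hB₂ : 0 < (⟪e₂, B e₂⟫_ℂ).re) :
    ∃ v : E, ‖v‖ = 1 ∧ (∀ x, ⟪x, e₁⟫_ℂ = 0 → ⟪x, e₂⟫_ℂ = 0 → ⟪x, v⟫_ℂ = 0) ∧
      ⟪v, A v⟫_ℂ = 0 ∧ ⟪v, B v⟫_ℂ = 0 := by
  have hnorm : ‖⟪e₁, A e₂⟫_ℂ‖ = ‖⟪e₂, A e₁⟫_ℂ‖ := by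
    rw [← hA e₁ e₂, norm_inner_symm]
  -- The plane is treated as a degenerate space with third vector `0`.
  obtain ⟨v, hv, hv3, hF, hg⟩ := exists_hollowForm_eq_zero_of_norm_eq
    ⟪e₁, A 0⟫_ℂ ⟪0, A e₁⟫_ℂ ⟪e₂, A 0⟫_ℂ ⟪0, A e₂⟫_ℂ hnorm
    (continuous_re_inner_combination B e₁ e₂ 0) (re_inner_combination_smul B e₁ e₂ 0)
    (by simpa using hB₁.le) (by simpa using hB₂.le)
  rw [← inner_combination_eq_hollowForm A hA₁ hA₂ (by simp)] at hF
  have hw : v.1 • e₁ + v.2.1 • e₂ + v.2.2 • (0 : E) ≠ 0 := by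
    intro h
    have o₂₁ : ⟪e₂, e₁⟫_ℂ = 0 := inner_eq_zero_symm.mp o₁₂
    have i₁ := congrArg (fun x => ⟪e₁, x⟫_ℂ) h
    have i₂ := congrArg (fun x => ⟪e₂, x⟫_ℂ) h
    simp only [inner_add_right, inner_smul_right, inner_zero_right, o₁₂, o₂₁,
      inner_self_eq_norm_sq_to_K, n₁, n₂] at i₁ i₂
    apply hv
    ext
    · simpa using i₁
    · simpa using i₂
    · simpa using hv3
  obtain ⟨u, hu, hspan, hiso⟩ := exists_unit_smul_isotropic hw
  refine ⟨u, hu, fun x h1 h2 => hspan x ?_, hiso A hF,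
    hiso B (inner_map_self_eq_zero_of_re hB hg)⟩
  simp [h1, h2]

/-- Three symmetric operators have a common isotropic unit vector in the span of three
orthonormal vectors isotropic for the first two, if the third changes sign on them. -/
theorem exists_isotropic_mem_space {A B C : E →ₗ[ℂ] E} (hA : A.IsSymmetric) (hB : B.IsSymmetric)
    (hC : C.IsSymmetric) {e₁ e₂ e₃ : E} (n₁ : ‖e₁‖ = 1) (n₂ : ‖e₂‖ = 1) (n₃ : ‖e₃‖ = 1)
    (o₁₂ : ⟪e₁, e₂⟫_ℂ = 0) (o₁₃ : ⟪e₁, e₃⟫_ℂ = 0) (o₂₃ : ⟪e₂, e₃⟫_ℂ = 0)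
    (hA₁ : ⟪e₁, A e₁⟫_ℂ = 0) (hA₂ : ⟪e₂, A e₂⟫_ℂ = 0) (hA₃ : ⟪e₃, A e₃⟫_ℂ = 0)
    (hB₁ : ⟪e₁, B e₁⟫_ℂ = 0) (hB₂ : ⟪e₂, B e₂⟫_ℂ = 0) (hB₃ : ⟪e₃, B e₃⟫_ℂ = 0)
    (hC₁ : (⟪e₁, C e₁⟫_ℂ).re < 0) (hC₂ : 0 < (⟪e₂, C e₂⟫_ℂ).re) :
    ∃ v : E, ‖v‖ = 1 ∧
      (∀ x, ⟪x, e₁⟫_ℂ = 0 → ⟪x, e₂⟫_ℂ = 0 → ⟪x, e₃⟫_ℂ = 0 → ⟪x, v⟫_ℂ = 0) ∧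
      ⟪v, A v⟫_ℂ = 0 ∧ ⟪v, B v⟫_ℂ = 0 ∧ ⟪v, C v⟫_ℂ = 0 := by
  have hM : ∀ x y, ⟪x, (A + Complex.I • B) y⟫_ℂ = ⟪x, A y⟫_ℂ + Complex.I * ⟪x, B y⟫_ℂ := by
    intro x y
    rw [LinearMap.add_apply, LinearMap.smul_apply, inner_add_right, inner_smul_right]
  obtain ⟨v, hv, hF, hg⟩ := exists_hollowForm_eq_zero
    ⟪e₁, (A + Complex.I • B) e₂⟫_ℂ ⟪e₂, (A + Complex.I • B) e₁⟫_ℂ ⟪e₁, (A + Complex.I • B) e₃⟫_ℂ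
    ⟪e₃, (A + Complex.I • B) e₁⟫_ℂ ⟪e₂, (A + Complex.I • B) e₃⟫_ℂ ⟪e₃, (A + Complex.I • B) e₂⟫_ℂ
    (continuous_re_inner_combination C e₁ e₂ e₃) (re_inner_combination_smul C e₁ e₂ e₃)
    (by simpa using hC₁) (by simpa using hC₂)
  rw [← inner_combination_eq_hollowForm _ (by rw [hM, hA₁, hB₁]; simp)
    (by rw [hM, hA₂, hB₂]; simp) (by rw [hM, hA₃, hB₃]; simp), hM] at hF
  set w := v.1 • e₁ + v.2.1 • e₂ + v.2.2 • e₃ with hwdef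
  have hAB : (⟪w, A w⟫_ℂ).re = 0 ∧ (⟪w, B w⟫_ℂ).re = 0 := by
    rw [← hA.coe_re_inner_self_apply w, ← hB.coe_re_inner_self_apply w] at hF
    have h1 := congrArg Complex.re hF
    have h2 := congrArg Complex.im hF
    simp at h1 h2
    exact ⟨h1, h2⟩
  have hw : w ≠ 0 := by
    intro h
    have o₂₁ : ⟪e₂, e₁⟫_ℂ = 0 := inner_eq_zero_symm.mp o₁₂
    have o₃₁ : ⟪e₃, e₁⟫_ℂ = 0 := inner_eq_zero_symm.mp o₁₃
    have o₃₂ : ⟪e₃, e₂⟫_ℂ = 0 := inner_eq_zero_symm.mp o₂₃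
    have i₁ := congrArg (fun x => ⟪e₁, x⟫_ℂ) h
    have i₂ := congrArg (fun x => ⟪e₂, x⟫_ℂ) h
    have i₃ := congrArg (fun x => ⟪e₃, x⟫_ℂ) h
    simp only [hwdef, inner_add_right, inner_smul_right, inner_zero_right, o₁₂, o₂₁, o₁₃, o₃₁,
      o₂₃, o₃₂, inner_self_eq_norm_sq_to_K, n₁, n₂, n₃] at i₁ i₂ i₃
    apply hv
    ext
    · simpa using i₁
    · simpa using i₂
    · simpa using i₃
  obtain ⟨u, hu, hspan, hiso⟩ := exists_unit_smul_isotropic hw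
  refine ⟨u, hu, fun x h1 h2 h3 => hspan x ?_, hiso A (inner_map_self_eq_zero_of_re hA hAB.1),
    hiso B (inner_map_self_eq_zero_of_re hB hAB.2), hiso C (inner_map_self_eq_zero_of_re hC hg)⟩
  simp [hwdef, h1, h2, h3]

/-! ### Changing orthonormal bases -/

variable {ι : Type*} [Fintype ι]

/-- A unit vector in the span of some vectors of an orthonormal basis can replace one of these,
keeping the vectors outside this set. -/
theorem OrthonormalBasis.exists_replace (b : OrthonormalBasis ι ℂ E) (S : Set ι) {i : ι}
    (hi : i ∈ S) {v : E} (hv : ‖v‖ = 1) (hS : ∀ l ∉ S, ⟪b l, v⟫_ℂ = 0) :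
    ∃ b' : OrthonormalBasis ι ℂ E, b' i = v ∧ ∀ l ∉ S, b' l = b l := by
  classical
  have hne : ∀ l ∉ S, l ≠ i := fun l hl h => hl (h ▸ hi)
  have ho : Orthonormal ℂ ((insert i Sᶜ : Set ι).domRestrict (Function.update b i v)) := by
    refine ⟨?_, ?_⟩
    · rintro ⟨l, hl⟩
      rcases hl with rfl | hl
      · simpa using hv
      · simp [Function.update_of_ne (hne l hl), b.orthonormal.1 l]
    · rintro ⟨l, hl⟩ ⟨m, hm⟩ hlm
      have hlm' : l ≠ m := fun h => hlm (Subtype.ext h)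
      rcases hl with rfl | hl <;> rcases hm with rfl | hm
      · exact absurd rfl hlm'
      · simpa [Function.update_of_ne (hne m hm)] using inner_eq_zero_symm.mp (hS m hm)
      · simpa [Function.update_of_ne (hne l hl)] using hS l hl
      · simpa [Function.update_of_ne (hne m hm), Function.update_of_ne (hne l hl)] using
          b.orthonormal.2 hlm'
  have := b.toBasis.finiteDimensional_of_finite
  obtain ⟨b', hb'⟩ := ho.exists_orthonormalBasis_extension_of_card_eq
    (Module.finrank_eq_card_basis b.toBasis)
  refine ⟨b', ?_, fun l hl => ?_⟩
  · rw [hb' i (Set.mem_insert _ _), Function.update_self]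
  · rw [hb' l (Set.mem_insert_of_mem _ hl), Function.update_of_ne (hne l hl)]

theorem sum_re_inner_eq_zero {T : E →ₗ[ℂ] E} (hT : T.trace ℂ E = 0) (b : OrthonormalBasis ι ℂ E) :
    ∑ l, (⟪b l, T (b l)⟫_ℂ).re = 0 := by
  rw [← Complex.re_sum, ← LinearMap.trace_eq_sum_inner T b, hT, Complex.zero_re]

/-- A symmetric traceless operator changes sign on an orthonormal basis or vanishes on it. -/
theorem exists_neg_pos_of_trace_eq_zero {T : E →ₗ[ℂ] E} (hT : T.IsSymmetric)
    (hTr : T.trace ℂ E = 0) (b : OrthonormalBasis ι ℂ E) (h : ∃ l, ⟪b l, T (b l)⟫_ℂ ≠ 0) :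
    ∃ i j, (⟪b i, T (b i)⟫_ℂ).re < 0 ∧ 0 < (⟪b j, T (b j)⟫_ℂ).re := by
  obtain ⟨l, hl⟩ := h
  have hl' : (⟪b l, T (b l)⟫_ℂ).re ≠ 0 := fun h => hl (inner_map_self_eq_zero_of_re hT h)
  have hs := sum_re_inner_eq_zero hTr b
  obtain ⟨j, -, hj⟩ := Finset.exists_pos_of_sum_zero_of_exists_nonzero _ hs
    ⟨l, Finset.mem_univ _, hl'⟩
  obtain ⟨i, -, hi⟩ := Finset.exists_pos_of_sum_zero_of_exists_nonzero
    (fun l => -(⟪b l, T (b l)⟫_ℂ).re) (by rw [Finset.sum_neg_distrib, hs, neg_zero])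
    ⟨l, Finset.mem_univ _, neg_ne_zero.mpr hl'⟩
  exact ⟨i, j, by linarith, hj⟩

/-- If a traceless operator vanishes on all vectors of an orthonormal basis but one, it vanishes
on this one, too. -/
theorem inner_eq_zero_of_trace_eq_zero {T : E →ₗ[ℂ] E} (hTr : T.trace ℂ E = 0)
    (b : OrthonormalBasis ι ℂ E) (j : ι) (h : ∀ l, l ≠ j → ⟪b l, T (b l)⟫_ℂ = 0) :
    ⟪b j, T (b j)⟫_ℂ = 0 := by
  rw [LinearMap.trace_eq_sum_inner T b, Finset.sum_eq_single j (fun l _ hl => h l hl) (by simp)]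
    at hTr
  exact hTr

open Classical in
/-- A basis that makes one traceless symmetric operator hollow can be changed into one that makes
two of them hollow, keeping the vectors that are isotropic for the second. -/
theorem exists_hollow_pair_of_hollow {A B : E →ₗ[ℂ] E} (hA : A.IsSymmetric) (hB : B.IsSymmetric)
    (hAtr : A.trace ℂ E = 0) (hBtr : B.trace ℂ E = 0) (b : OrthonormalBasis ι ℂ E)
    (hb : ∀ l, ⟪b l, A (b l)⟫_ℂ = 0) :
    ∃ b' : OrthonormalBasis ι ℂ E, (∀ l, ⟪b' l, A (b' l)⟫_ℂ = 0) ∧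
      (∀ l, ⟪b' l, B (b' l)⟫_ℂ = 0) ∧ ∀ l, ⟪b l, B (b l)⟫_ℂ = 0 → b' l = b l := by
  induction hN : (Finset.univ.filter fun l => ⟪b l, B (b l)⟫_ℂ ≠ 0).card using
    Nat.strong_induction_on generalizing b with
  | _ N ih =>
  by_cases h0 : ∀ l, ⟪b l, B (b l)⟫_ℂ = 0
  · exact ⟨b, hb, h0, fun _ _ => rfl⟩
  push Not at h0
  obtain ⟨i, j, hi, hj⟩ := exists_neg_pos_of_trace_eq_zero hB hBtr b h0
  have hij : i ≠ j := by
    rintro rfl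
    exact lt_asymm hi hj
  have hi0 : ⟪b i, B (b i)⟫_ℂ ≠ 0 := fun h => by simp [h] at hi
  have hj0 : ⟪b j, B (b j)⟫_ℂ ≠ 0 := fun h => by simp [h] at hj
  obtain ⟨v, hv, hspan, hAv, hBv⟩ := exists_isotropic_mem_plane hA hB (b.orthonormal.1 i)
    (b.orthonormal.1 j) (b.orthonormal.2 hij) (hb i) (hb j) hi hj
  obtain ⟨b₁, h₁, h₁'⟩ := b.exists_replace {i, j} (Set.mem_insert i _) hv (by
    intro l hl
    simp only [Set.mem_insert_iff, Set.mem_singleton_iff, not_or] at hl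
    exact hspan _ (b.orthonormal.2 hl.1) (b.orthonormal.2 hl.2))
  have hkeep : ∀ l, l ≠ i → l ≠ j → b₁ l = b l := fun l hli hlj => h₁' l (by simp [hli, hlj])
  have hb₁ : ∀ l, l ≠ j → ⟪b₁ l, A (b₁ l)⟫_ℂ = 0 := by
    intro l hlj
    by_cases hli : l = i
    · rw [hli, h₁, hAv]
    · rw [hkeep l hli hlj, hb l]
  have hcard : (Finset.univ.filter fun l => ⟪b₁ l, B (b₁ l)⟫_ℂ ≠ 0).card < N := by
    rw [← hN]
    refine Finset.card_lt_card ⟨fun l hl => ?_, fun h => ?_⟩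
    · simp only [Finset.mem_filter, Finset.mem_univ, true_and] at hl ⊢
      by_cases hli : l = i
      · rwa [hli]
      by_cases hlj : l = j
      · rwa [hlj]
      rwa [hkeep l hli hlj] at hl
    · have := h (show i ∈ _ by simpa using hi0)
      simp [h₁, hBv] at this
  obtain ⟨b₂, hA₂, hB₂, h₂⟩ := ih _ hcard b₁ (fun l => by
    by_cases hlj : l = j
    · rw [hlj]
      exact inner_eq_zero_of_trace_eq_zero hAtr b₁ j hb₁
    · exact hb₁ l hlj) rfl
  refine ⟨b₂, hA₂, hB₂, fun l hl => ?_⟩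
  have hl₁ : b₁ l = b l := hkeep l (fun h => hi0 (h ▸ hl)) (fun h => hj0 (h ▸ hl))
  rw [h₂ l (by rw [hl₁, hl]), hl₁]

/-- An orthonormal basis can be changed into one that makes two traceless symmetric operators
hollow, keeping the vectors that are isotropic for both. -/
theorem exists_hollow_pair {A B : E →ₗ[ℂ] E} (hA : A.IsSymmetric) (hB : B.IsSymmetric)
    (hAtr : A.trace ℂ E = 0) (hBtr : B.trace ℂ E = 0) (b : OrthonormalBasis ι ℂ E) :
    ∃ b' : OrthonormalBasis ι ℂ E, (∀ l, ⟪b' l, A (b' l)⟫_ℂ = 0) ∧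
      (∀ l, ⟪b' l, B (b' l)⟫_ℂ = 0) ∧
      ∀ l, ⟪b l, A (b l)⟫_ℂ = 0 → ⟪b l, B (b l)⟫_ℂ = 0 → b' l = b l := by
  -- Every basis is hollow for the zero operator, so the same lemma also handles `A` alone.
  obtain ⟨b₁, -, hA₁, h₁⟩ := exists_hollow_pair_of_hollow LinearMap.IsSymmetric.zero hA
    (map_zero _) hAtr b (by simp)
  obtain ⟨b₂, hA₂, hB₂, h₂⟩ := exists_hollow_pair_of_hollow hA hB hAtr hBtr b₁ hA₁
  refine ⟨b₂, hA₂, hB₂, fun l hlA hlB => ?_⟩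
  have hl := h₁ l hlA
  rw [h₂ l (by rw [hl, hlB]), hl]

open Classical in
/-- Three traceless symmetric operators have an orthonormal basis that makes two of them hollow,
and the third one up to at most two diagonal entries. -/
theorem exists_hollow_pair_card_le_two {A B C : E →ₗ[ℂ] E} (hA : A.IsSymmetric)
    (hB : B.IsSymmetric) (hC : C.IsSymmetric) (hAtr : A.trace ℂ E = 0) (hBtr : B.trace ℂ E = 0)
    (hCtr : C.trace ℂ E = 0) (b : OrthonormalBasis ι ℂ E) :
    ∃ b' : OrthonormalBasis ι ℂ E, (∀ l, ⟪b' l, A (b' l)⟫_ℂ = 0) ∧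
      (∀ l, ⟪b' l, B (b' l)⟫_ℂ = 0) ∧
      (Finset.univ.filter fun l => ⟪b' l, C (b' l)⟫_ℂ ≠ 0).card ≤ 2 := by
  obtain ⟨b, hbA, hbB, -⟩ := exists_hollow_pair hA hB hAtr hBtr b
  induction hN : (Finset.univ.filter fun l => ⟪b l, C (b l)⟫_ℂ ≠ 0).card using
    Nat.strong_induction_on generalizing b with
  | _ N ih =>
  by_cases h2 : N ≤ 2
  · exact ⟨b, hbA, hbB, hN ▸ h2⟩
  have hpos : 0 < (Finset.univ.filter fun l => ⟪b l, C (b l)⟫_ℂ ≠ 0).card := by omega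
  obtain ⟨l₀, hl₀⟩ := Finset.card_pos.mp hpos
  obtain ⟨i, j, hi, hj⟩ := exists_neg_pos_of_trace_eq_zero hC hCtr b
    ⟨l₀, (Finset.mem_filter.mp hl₀).2⟩
  have hij : i ≠ j := by
    rintro rfl
    exact lt_asymm hi hj
  -- The third index also carries a nonzero entry of `C`, so disturbing it creates no new one.
  obtain ⟨k, hk, hk'⟩ : ∃ k ∈ Finset.univ.filter (fun l => ⟪b l, C (b l)⟫_ℂ ≠ 0),
      k ∉ ({i, j} : Finset ι) := Finset.exists_mem_notMem_of_card_lt_card (by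
    have := Finset.card_le_two (a := i) (b := j)
    omega)
  simp only [Finset.mem_insert, Finset.mem_singleton, not_or] at hk'
  have hi0 : ⟪b i, C (b i)⟫_ℂ ≠ 0 := fun h => by simp [h] at hi
  have hj0 : ⟪b j, C (b j)⟫_ℂ ≠ 0 := fun h => by simp [h] at hj
  have hk0 : ⟪b k, C (b k)⟫_ℂ ≠ 0 := (Finset.mem_filter.mp hk).2
  obtain ⟨v, hv, hspan, hAv, hBv, hCv⟩ := exists_isotropic_mem_space hA hB hC
    (b.orthonormal.1 i) (b.orthonormal.1 j) (b.orthonormal.1 k) (b.orthonormal.2 hij)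
    (b.orthonormal.2 (Ne.symm hk'.1)) (b.orthonormal.2 (Ne.symm hk'.2)) (hbA i) (hbA j) (hbA k)
    (hbB i) (hbB j) (hbB k) hi hj
  obtain ⟨b₁, h₁, h₁'⟩ := b.exists_replace {i, j, k} (Set.mem_insert i _) hv (by
    intro l hl
    simp only [Set.mem_insert_iff, Set.mem_singleton_iff, not_or] at hl
    exact hspan _ (b.orthonormal.2 hl.1) (b.orthonormal.2 hl.2.1) (b.orthonormal.2 hl.2.2))
  -- Replacing one vector may spoil `A` and `B` at `j` and `k`; the repair keeps `v` and all vectors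
  -- outside the triple.
  obtain ⟨b₂, hA₂, hB₂, h₂⟩ := exists_hollow_pair hA hB hAtr hBtr b₁
  have h₂i : b₂ i = v := by
    rw [h₂ i (by rw [h₁, hAv]) (by rw [h₁, hBv]), h₁]
  have hkeep : ∀ l, l ≠ i → l ≠ j → l ≠ k → b₂ l = b l := by
    intro l hli hlj hlk
    have hl : b₁ l = b l := h₁' l (by simp [hli, hlj, hlk])
    rw [h₂ l (by rw [hl, hbA]) (by rw [hl, hbB]), hl]
  refine ih _ ?_ b₂ hA₂ hB₂ rfl
  rw [← hN]
  refine Finset.card_lt_card ⟨fun l hl => ?_, fun h => ?_⟩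
  · simp only [Finset.mem_filter, Finset.mem_univ, true_and] at hl ⊢
    by_cases hli : l = i
    · rwa [hli]
    by_cases hlj : l = j
    · rwa [hlj]
    by_cases hlk : l = k
    · rwa [hlk]
    rwa [hkeep l hli hlj hlk] at hl
  · have := h (show i ∈ _ by simpa using hi0)
    simp [h₂i, hCv] at this

end HollowBases

/-! ### Back to matrices -/

/-- A set of at most two indices can be moved to the last two places. -/
theorem exists_perm_forall_add_two_lt {n : ℕ} (hn : 2 ≤ n) {N : Finset (Fin n)}
    (hN : N.card ≤ 2) : ∃ σ : Equiv.Perm (Fin n), ∀ i : Fin n, (i : ℕ) + 2 < n → σ i ∉ N := by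
  classical
  -- Padding to exactly two elements gives a bijection with the last two places, which extends to a
  -- permutation.
  obtain ⟨N', hNN', -, hN'⟩ := Finset.exists_subsuperset_card_eq (Finset.subset_univ N) hN
    (by simpa using hn)
  let p : Fin n := ⟨n - 2, by omega⟩
  let q : Fin n := ⟨n - 1, by omega⟩
  have hpq : p ≠ q := by
    simp only [p, q, ne_eq, Fin.mk.injEq]
    omega
  have hT : ({p, q} : Finset (Fin n)).card = N'.card := by rw [Finset.card_pair hpq, hN']
  refine ⟨(Finset.equivOfCardEq hT).extendSubtype, fun i hi hσ => ?_⟩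
  refine Equiv.extendSubtype_not_mem (Finset.equivOfCardEq hT) i ?_ (hNN' hσ)
  simp only [Finset.mem_insert, Finset.mem_singleton, not_or, p, q, Fin.ext_iff]
  omega

theorem orthonormalBasis_inner_toEuclideanLin {n : ℕ} (A V : Matrix (Fin n) (Fin n) ℂ)
    (b : OrthonormalBasis (Fin n) ℂ (EuclideanSpace ℂ (Fin n))) (hV : ∀ i j, V i j = b j i)
    (j : Fin n) : (Vᴴ * A * V) j j = ⟪b j, A.toEuclideanLin (b j)⟫_ℂ := by
  have hcol : V.col j = (b j).ofLp := funext fun i => hV i j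
  rw [EuclideanSpace.inner_eq_star_dotProduct, Matrix.toLpLin_apply, dotProduct_comm, ← hcol,
    Matrix.mul_assoc, Matrix.mul_apply]
  simp [dotProduct, Matrix.mul_apply, Matrix.mulVec, Matrix.col]

theorem proposition2p9 (n : ℕ) (A B C : Matrix (Fin n) (Fin n) ℂ)
    (hA : A.IsHermitian) (hB : B.IsHermitian) (hC : C.IsHermitian)
    (hAtr : A.trace = 0) (hBtr : B.trace = 0) (hCtr : C.trace = 0) :
    (3 ≤ n → ∃ v : Fin n → ℂ, v ≠ 0 ∧
      star v ⬝ᵥ (A *ᵥ v) = 0 ∧ star v ⬝ᵥ (B *ᵥ v) = 0 ∧ star v ⬝ᵥ (C *ᵥ v) = 0) ∧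
    (∃ V ∈ Matrix.unitaryGroup (Fin n) ℂ,
      IsHollow (Vᴴ * A * V) ∧ IsHollow (Vᴴ * B * V) ∧ IsAlmostHollow (Vᴴ * C * V)) := by
  classical
  have htr : ∀ M : Matrix (Fin n) (Fin n) ℂ, M.trace = 0 →
      M.toEuclideanLin.trace ℂ (EuclideanSpace ℂ (Fin n)) = 0 := by
    intro M hM
    rw [Matrix.toEuclideanLin, Matrix.toLpLin_eq_toLin, Matrix.trace_toLin_eq, hM]
  obtain ⟨b₀, hbA, hbB, hbC⟩ := exists_hollow_pair_card_le_two
    (Matrix.isSymmetric_toEuclideanLin_iff.mpr hA) (Matrix.isSymmetric_toEuclideanLin_iff.mpr hB)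
    (Matrix.isSymmetric_toEuclideanLin_iff.mpr hC) (htr A hAtr) (htr B hBtr) (htr C hCtr)
    (EuclideanSpace.basisFun (Fin n) ℂ)
  obtain ⟨σ, hσ⟩ : ∃ σ : Equiv.Perm (Fin n), ∀ i : Fin n, (i : ℕ) + 2 < n →
      ⟪b₀ (σ i), C.toEuclideanLin (b₀ (σ i))⟫_ℂ = 0 := by
    by_cases hn : 2 ≤ n
    · obtain ⟨σ, hσ⟩ := exists_perm_forall_add_two_lt hn hbC
      exact ⟨σ, fun i hi => by simpa using hσ i hi⟩
    · exact ⟨1, fun i hi => by omega⟩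
  set b := b₀.reindex σ.symm with hb
  have hbσ : ∀ i, b i = b₀ (σ i) := fun i => by simp [hb]
  let V : Matrix (Fin n) (Fin n) ℂ := Matrix.of fun i j => b j i
  have hV : ∀ i j, V i j = b j i := fun _ _ => rfl
  have hVu : V ∈ Matrix.unitaryGroup (Fin n) ℂ :=
    (EuclideanSpace.basisFun (Fin n) ℂ).toMatrix_orthonormalBasis_mem_unitary b
  have hCV : ∀ i : Fin n, (i : ℕ) + 2 < n → (Vᴴ * C * V) i i = 0 := fun i hi => by
    rw [orthonormalBasis_inner_toEuclideanLin C V b hV, hbσ, hσ i hi]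
  have htrV : (Vᴴ * C * V).trace = 0 := by
    rw [Matrix.trace_mul_cycle, ← Matrix.star_eq_conjTranspose,
      Matrix.mem_unitaryGroup_iff.mp hVu, Matrix.one_mul, hCtr]
  refine ⟨fun hn => ?_, V, hVu, fun i => ?_, fun i => ?_, hCV, fun i j hi hj => ?_, fun hn i => ?_⟩
  · let o : Fin n := ⟨0, by omega⟩
    have hq : ∀ M : Matrix (Fin n) (Fin n) ℂ, star (b o).ofLp ⬝ᵥ (M *ᵥ (b o).ofLp) =
        ⟪b o, M.toEuclideanLin (b o)⟫_ℂ := by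
      intro M
      rw [EuclideanSpace.inner_eq_star_dotProduct, Matrix.toLpLin_apply, dotProduct_comm]
    refine ⟨(b o).ofLp, fun h => ?_, ?_, ?_, ?_⟩
    · exact b.orthonormal.ne_zero o ((WithLp.ofLp_eq_zero 2).mp h)
    · rw [hq, hbσ, hbA]
    · rw [hq, hbσ, hbB]
    · rw [hq, hbσ]
      exact hσ o (by simp only [o]; omega)
  · rw [orthonormalBasis_inner_toEuclideanLin A V b hV, hbσ, hbA]
  · rw [orthonormalBasis_inner_toEuclideanLin B V b hV, hbσ, hbB]
  · have hij : i ≠ j := by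
      rintro rfl
      omega
    rw [Matrix.trace, ← Finset.sum_subset (Finset.subset_univ {i, j}), Finset.sum_pair hij] at htrV
    · exact eq_neg_of_add_eq_zero_left htrV
    · intro l _ hl
      simp only [Finset.mem_insert, Finset.mem_singleton, not_or, Fin.ext_iff] at hl
      exact hCV l (by have := l.isLt; omega)
  · subst hn
    rw [Matrix.trace, Fin.sum_univ_one] at htrV
    rwa [Subsingleton.elim i 0]
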